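/- Let $\mathbb{U}$ be a real or complex Banach Lie group, that is, a group that is also an analytic manifold modelled on a Banach space, with analytic multiplication and inversion. Let $d$ be a left-invariant or right-invariant metric inducing the topology of $\mathbb{U}$. Let $\mathbb{G}\le\mathbb{U}$ be a Lie subgroup, i.e. a subgroup that is a split submanifold: around each point of $\mathbb{G}$ there is an analytic chart of $\mathbb{U}$ which carries $\mathbb{G}$ to a closed complemented linear subspace of the model space. Let $S\subseteq\mathbb{U}$ be ad-bounded, i.e. $\sup_{g\in S}\|\mathrm{Ad}_g\|<\infty$, where $\mathrm{Ad}$ is the adjoint representation of $\mathbb{U}$ on its Lie algebra. Then for every $\varepsilon>0$ there is a neighborhood $U_0$ of $1$ in $\mathbb{U}$ such that for every compact group $\mathbb{K}$ and every continuous group homomorphism $\varphi:\mathbb{K}\to\mathbb{U}$ with $\varphi(\mathbb{K})\subseteq(\mathbb{G}\cdot U_0)\cap S$ there is a continuous group homomorphism $\psi:\mathbb{K}\to\mathbb{G}$ with $d(\varphi(s),\psi(s))<\varepsilon$ for all $s\in\mathbb{K}$. If moreover $\varphi$ is an embedding (a homeomorphism onto its image), then $\psi$ can also be taken to be an embedding.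 -/

import Mathlib

open scoped Manifold ContDiff Topology Pointwise

namespace BanachLie

section

variable (𝕜 : Type*) [RCLike 𝕜] (E : Type*) [NormedAddCommGroup E] [NormedSpace 𝕜 E]
  {U : Type*} [Group U] [TopologicalSpace U] [ChartedSpace E U]

/-- The adjoint representation of a Lie group `U` modelled on `E`: `Ad g` is the derivative at `1`
of the conjugation `x ↦ g x g⁻¹`. The Lie algebra `T₁U` is carried by the space `E` (through the
preferred chart at `1`). -/
noncomputable def Ad (g : U) : E →L[𝕜] E :=
  mfderiv 𝓘(𝕜, E) 𝓘(𝕜, E) (fun x : U => g * x * g⁻¹) (1 : U)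

/-- `S` is ad-bounded: the operators `Ad g`, `g ∈ S`, are uniformly bounded on the Lie algebra. -/
def AdBounded (S : Set U) : Prop :=
  ∃ C : ℝ, ∀ g ∈ S, ‖Ad 𝕜 E g‖ ≤ C

/-- `G` is a Lie subgroup of `U`: a subgroup that is a (split, embedded) analytic submanifold, i.e.
around each of its points there is an analytic chart `χ` of `U` which carries `G` to a closed
subspace `F` of `E` having a closed complement. -/
def IsLieSubgroup (G : Subgroup U) : Prop :=
  ∀ g ∈ G, ∃ χ ∈ IsManifold.maximalAtlas 𝓘(𝕜, E) ω U, g ∈ χ.source ∧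
    ∃ F : Submodule 𝕜 E, F.ClosedComplemented ∧ ∀ x ∈ χ.source, x ∈ G ↔ χ x ∈ F

end

end BanachLie

/-!
A homomorphism `φ` from a compact group `K` to `U` makes `K` act on `U ⧸ G` by left translations,
and `x⁻¹ * φ s * x ∈ G` for all `s` says that the coset `x * G` is fixed. If `φ` takes values in
`G * U₀`, then the base coset is nearly fixed. Near it, the action is read in a chart of `U ⧸ G`;
since `φ` has ad-bounded image, the resulting local maps are quadratically approximable by affine
ones with a constant that does not depend on `φ`. Moving a point with displacement `η` to the Haar
mean of its orbit therefore leaves a displacement of order `η ^ 2`, and iteration converges to a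
fixed coset `x * G` with `x` near `1`. Conjugating `φ` by `x⁻¹` gives `ψ`.
-/

namespace BanachLie

open Set Metric Filter

open scoped NNReal

section QuadApprox

variable {𝕜 : Type*} [RCLike 𝕜] {X Y Z : Type*} [NormedAddCommGroup X] [NormedSpace 𝕜 X]
  [NormedAddCommGroup Y] [NormedSpace 𝕜 Y] [NormedAddCommGroup Z] [NormedSpace 𝕜 Z]

variable (𝕜) in
/-- At each point of `B` the map `f` has an affine approximation, valid on all of `B` with a
quadratic error. One constant `C` bounds both the linear parts and the errors, so that a family of
maps can be required to satisfy this uniformly. -/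
def QuadApprox (f : X → Y) (B : Set X) (C : ℝ≥0) : Prop :=
  ∀ v ∈ B, ∃ D : X →L[𝕜] Y, ‖D‖ ≤ C ∧ ∀ y ∈ B, ‖f y - f v - D (y - v)‖ ≤ C * ‖y - v‖ ^ 2

theorem QuadApprox.mono {f : X → Y} {A B : Set X} {C : ℝ≥0} (h : QuadApprox 𝕜 f B C)
    (hAB : A ⊆ B) : QuadApprox 𝕜 f A C := fun v hv =>
  let ⟨D, hD, hDf⟩ := h v (hAB hv)
  ⟨D, hD, fun y hy => hDf y (hAB hy)⟩

theorem QuadApprox.norm_sub_le {f : X → Y} {B : Set X} {C : ℝ≥0} (h : QuadApprox 𝕜 f B C)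
    {x y : X} (hx : x ∈ B) (hy : y ∈ B) : ‖f y - f x‖ ≤ C * ‖y - x‖ ^ 2 + C * ‖y - x‖ := by
  obtain ⟨D, hD, hDf⟩ := h x hx
  calc ‖f y - f x‖ = ‖(f y - f x - D (y - x)) + D (y - x)‖ := by rw [sub_add_cancel]
    _ ≤ C * ‖y - x‖ ^ 2 + C * ‖y - x‖ :=
        (norm_add_le _ _).trans (add_le_add (hDf y hy) (D.le_of_opNorm_le hD _))

theorem QuadApprox.continuousOn {f : X → Y} {B : Set X} {C : ℝ≥0} (h : QuadApprox 𝕜 f B C) :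
    ContinuousOn f B := by
  intro x hx
  have hbound : Tendsto (fun y => C * ‖y - x‖ ^ 2 + C * ‖y - x‖) (𝓝[B] x) (𝓝 0) := by
    have hcont : Continuous fun y => C * ‖y - x‖ ^ 2 + C * ‖y - x‖ := by fun_prop
    simpa using (hcont.tendsto x).mono_left nhdsWithin_le_nhds
  refine tendsto_iff_norm_sub_tendsto_zero.2 (squeeze_zero' ?_ ?_ hbound)
  · exact Eventually.of_forall fun y => norm_nonneg _
  · exact eventually_mem_nhdsWithin.mono fun y hy => h.norm_sub_le hx hy

theorem QuadApprox.comp {f : X → Y} {g : Y → Z} {A : Set X} {B : Set Y} {C C' K : ℝ≥0}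
    (hg : QuadApprox 𝕜 g B C') (hf : QuadApprox 𝕜 f A C) (hfL : LipschitzOnWith K f A)
    (hAB : MapsTo f A B) : QuadApprox 𝕜 (g ∘ f) A (C' * K ^ 2 + C' * C) := by
  intro v hv
  obtain ⟨D, hD, hDf⟩ := hf v hv
  obtain ⟨D', hD', hDg⟩ := hg (f v) (hAB hv)
  refine ⟨D' ∘L D, ?_, fun y hy => ?_⟩
  · calc ‖D' ∘L D‖ ≤ C' * C := (D'.opNorm_comp_le D).trans (by gcongr)
      _ ≤ ↑(C' * K ^ 2 + C' * C) := by exact_mod_cast le_add_self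
  · calc ‖g (f y) - g (f v) - (D' ∘L D) (y - v)‖
        = ‖(g (f y) - g (f v) - D' (f y - f v)) + D' (f y - f v - D (y - v))‖ := by
          rw [map_sub D' (f y - f v), ContinuousLinearMap.comp_apply, sub_add_sub_cancel]
      _ ≤ C' * ‖f y - f v‖ ^ 2 + C' * (C * ‖y - v‖ ^ 2) :=
          (norm_add_le _ _).trans (add_le_add (hDg _ (hAB hy))
            (D'.le_of_opNorm_le_of_le hD' (hDf y hy)))
      _ ≤ C' * (K * ‖y - v‖) ^ 2 + C' * (C * ‖y - v‖ ^ 2) := by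
          gcongr; exact hfL.norm_sub_le hy hv
      _ = ↑(C' * K ^ 2 + C' * C) * ‖y - v‖ ^ 2 := by push_cast; ring

theorem QuadApprox.comp_prodMk_right {f : X × Y → Z} {a : X} {b b' : Y} {r : ℝ} {C : ℝ≥0}
    (h : QuadApprox 𝕜 f (ball (a, b) r) C) (hb' : b' ∈ ball b r) :
    QuadApprox 𝕜 (fun x => f (x, b')) (ball a r) C := by
  rw [← ball_prod_same] at h
  intro v hv
  obtain ⟨D, hD, hDf⟩ := h (v, b') ⟨hv, hb'⟩
  refine ⟨D ∘L ContinuousLinearMap.inl 𝕜 X Y, ?_, fun y hy => ?_⟩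
  · calc ‖D ∘L ContinuousLinearMap.inl 𝕜 X Y‖
        ≤ ‖D‖ * ‖ContinuousLinearMap.inl 𝕜 X Y‖ := D.opNorm_comp_le _
      _ ≤ C * 1 := by gcongr; exact ContinuousLinearMap.norm_inl_le_one 𝕜 X Y
      _ = C := mul_one _
  · simpa [Prod.norm_def] using hDf (y, b') ⟨hy, hb'⟩

theorem quadApprox_of_hasFDerivAt {f : X → Y} {f' : X → X →L[𝕜] Y} {a : X} {r : ℝ} {C : ℝ≥0}
    (hf : ∀ x ∈ ball a r, HasFDerivAt f (f' x) x) (hC : ∀ x ∈ ball a r, ‖f' x‖ ≤ C)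
    (hL : LipschitzOnWith C f' (ball a r)) : QuadApprox 𝕜 f (ball a r) C := by
  let _ : NormedSpace ℝ X := NormedSpace.restrictScalars ℝ 𝕜 X
  intro v hv
  refine ⟨f' v, hC v hv, fun y hy => ?_⟩
  have hseg : segment ℝ v y ⊆ ball a r := (convex_ball a r).segment_subset hv hy
  have hvar : ∀ x ∈ segment ℝ v y, ‖f' x - f' v‖ ≤ C * ‖y - v‖ := fun x hx =>
    (hL.norm_sub_le (hseg hx) hv).trans (by
      gcongr; simpa only [norm_sub_rev _ v] using norm_sub_le_of_mem_segment hx)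
  calc ‖f y - f v - f' v (y - v)‖ ≤ C * ‖y - v‖ * ‖y - v‖ :=
        (convex_segment v y).norm_image_sub_le_of_norm_hasFDerivWithin_le'
          (fun x hx => (hf x (hseg hx)).hasFDerivWithinAt) hvar
          (left_mem_segment ℝ v y) (right_mem_segment ℝ v y)
    _ = C * ‖y - v‖ ^ 2 := by ring

theorem exists_lipschitzOnWith_norm_le {f : X → Y} {a : X} (hf : ContDiffAt 𝕜 1 f a) :
    ∃ C : ℝ≥0, ∃ t ∈ 𝓝 a, LipschitzOnWith C f t ∧ ∀ x ∈ t, ‖f x‖ ≤ C := by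
  obtain ⟨K, t, ht, hK⟩ := hf.exists_lipschitzOnWith
  have hbdd : ∀ᶠ x in 𝓝 a, ‖f x‖ < ‖f a‖₊ + 1 :=
    hf.continuousAt.norm.eventually_lt_const (lt_add_one _)
  exact ⟨K + (‖f a‖₊ + 1), _, inter_mem ht hbdd,
    (hK.weaken le_self_add).mono inter_subset_left,
    fun x hx => (le_of_lt hx.2).trans (by exact_mod_cast le_add_self)⟩

theorem exists_quadApprox_of_contDiffAt {f : X → Y} {a : X} (hf : ContDiffAt 𝕜 2 f a) :
    ∃ C : ℝ≥0, ∀ᶠ r in 𝓝 (0 : ℝ), QuadApprox 𝕜 f (ball a r) C := by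
  obtain ⟨C, t, ht, hL, hC⟩ := exists_lipschitzOnWith_norm_le
    (hf.fderiv_right (m := 1) (by norm_num))
  have hdiff : ∀ᶠ x in 𝓝 a, DifferentiableAt 𝕜 f x :=
    (hf.eventually (by simp)).mono fun x hx => hx.differentiableAt (by simp)
  refine ⟨C, (eventually_ball_subset (inter_mem ht hdiff)).mono fun r hr => ?_⟩
  exact quadApprox_of_hasFDerivAt (fun x hx => (hr hx).2.hasFDerivAt) (fun x hx => hC x (hr hx).1)
    (hL.mono fun x hx => (hr hx).1)

theorem lipschitzOnWith_clm_comp {α : Type*} [PseudoMetricSpace α] {S : α → Y →L[𝕜] Z}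
    {T : α → X →L[𝕜] Y} {s : Set α} {K K' b b' : ℝ≥0} (hS : LipschitzOnWith K S s)
    (hSb : ∀ x ∈ s, ‖S x‖ ≤ b) (hT : LipschitzOnWith K' T s) (hTb : ∀ x ∈ s, ‖T x‖ ≤ b') :
    LipschitzOnWith (K * b' + b * K') (fun x => S x ∘L T x) s := by
  refine LipschitzOnWith.of_dist_le_mul fun x hx y hy => ?_
  rw [dist_eq_norm]
  calc ‖S x ∘L T x - S y ∘L T y‖ = ‖(S x - S y) ∘L T x + S y ∘L (T x - T y)‖ := by
        rw [ContinuousLinearMap.sub_comp, ContinuousLinearMap.comp_sub, sub_add_sub_cancel]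
    _ ≤ ‖S x - S y‖ * ‖T x‖ + ‖S y‖ * ‖T x - T y‖ :=
        (norm_add_le _ _).trans (add_le_add (ContinuousLinearMap.opNorm_comp_le _ _)
          (ContinuousLinearMap.opNorm_comp_le _ _))
    _ ≤ K * dist x y * b' + b * (K' * dist x y) := by
        gcongr
        · exact dist_eq_norm (S x) (S y) ▸ hS.dist_le_mul x hx y hy
        · exact hTb x hx
        · exact hSb y hy
        · exact dist_eq_norm (T x) (T y) ▸ hT.dist_le_mul x hx y hy
    _ = ↑(K * b' + b * K') * dist x y := by push_cast; ring

end QuadApprox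

section FixedPoint

open MeasureTheory

theorem exists_seq_tendsto_of_halving {X : Type*} [PseudoMetricSpace X] [CompleteSpace X]
    {P : ℝ → X → Prop} (step : ∀ η x, P η x → ∃ y, dist x y ≤ η ∧ P (η / 2) y) {δ : ℝ} {x₀ : X}
    (h₀ : P δ x₀) :
    ∃ (u : ℕ → X) (x : X), Tendsto u atTop (𝓝 x) ∧ ∀ n, P (δ / 2 ^ n) (u n) := by
  choose! next hdist hnext using step
  let u : ℕ → X := fun n => Nat.rec x₀ (fun k x => next (δ / 2 ^ k) x) n
  have hu : ∀ n, P (δ / 2 ^ n) (u n) := fun n => by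
    induction n with
    | zero => simpa [u] using h₀
    | succ k ih => rw [pow_succ, ← div_div]; exact hnext _ _ ih
  have hcauchy : CauchySeq u := cauchySeq_of_le_geometric_two (C := 2 * δ) fun n => by
    rw [mul_div_cancel_left₀ _ two_ne_zero]
    exact hdist _ _ (hu n)
  obtain ⟨x, hx⟩ := cauchySeq_tendsto_of_complete hcauchy
  exact ⟨u, x, hx, hu⟩

theorem norm_integral_sub_le {Ω X : Type*} [MeasurableSpace Ω] [NormedAddCommGroup X]
    [NormedSpace ℝ X] [CompleteSpace X] {μ : Measure Ω} [IsProbabilityMeasure μ] {f : Ω → X}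
    (hf : Integrable f μ) {a : X} {b : ℝ} (hb : ∀ t, ‖f t - a‖ ≤ b) : ‖∫ t, f t ∂μ - a‖ ≤ b :=
  mem_closedBall_iff_norm.1 <| (convex_closedBall a b).integral_mem isClosed_closedBall
    (Eventually.of_forall fun t => mem_closedBall_iff_norm.2 (hb t)) hf

variable {𝕜 : Type*} [RCLike 𝕜] {X : Type*} [NormedAddCommGroup X] [NormedSpace 𝕜 X]
  {K : Type*} [Group K] [TopologicalSpace K]

variable (𝕜) in
/-- `α` is a local action of `K` on the ball of radius `ρ` around `0`: the maps `α s` need not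
preserve the ball, the action law holds where it makes sense, orbit maps are continuous, and all
`α s` are quadratically approximable with the same constant `C`. -/
structure IsQuadLocalAction (α : K → X → X) (ρ : ℝ) (C : ℝ≥0) : Prop where
  quadApprox : ∀ s, QuadApprox 𝕜 (α s) (ball 0 ρ) C
  mul_apply : ∀ s t, ∀ v ∈ ball (0 : X) ρ, α t v ∈ ball (0 : X) ρ → α s (α t v) = α (s * t) v
  continuous_orbit : ∀ v ∈ ball (0 : X) ρ, Continuous fun s => α s v

variable [IsTopologicalGroup K] [CompactSpace K] [CompleteSpace X] {α : K → X → X} {ρ : ℝ}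
  {C : ℝ≥0}

/-- For `p' = ∫ α t p` and `D` the linear part of `α s` at `p'`, invariance of the Haar measure
turns `α s p' - p'` into the mean of `α s p' - α s (α t p) + D (α t p - p')`, a second order error
term. -/
theorem IsQuadLocalAction.exists_displacement_le (hα : IsQuadLocalAction 𝕜 α ρ C) {p : X} {η : ℝ}
    (hη : ∀ s, ‖α s p - p‖ ≤ η) (hp : ‖p‖ + η < ρ) :
    ∃ p' : X, ‖p' - p‖ ≤ η ∧ ∀ s, ‖α s p' - p'‖ ≤ 4 * C * η ^ 2 := by
  let _ : NormedSpace ℝ X := NormedSpace.restrictScalars ℝ 𝕜 X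
  let _ : MeasurableSpace K := borel K
  have _ : BorelSpace K := ⟨rfl⟩
  let μ : Measure K := Measure.haarMeasure ⊤
  have _ : IsProbabilityMeasure μ := ⟨Measure.haarMeasure_self (K₀ := ⊤)⟩
  have hint : ∀ {f : K → X}, Continuous f → Integrable f μ := fun hf =>
    hf.integrable_of_hasCompactSupport (HasCompactSupport.of_compactSpace _)
  have hmem : ∀ {v}, ‖v - p‖ ≤ η → v ∈ ball (0 : X) ρ := fun {v} hv =>
    mem_ball_zero_iff.2 <| by linarith [norm_le_norm_add_norm_sub' v p]
  have hpρ : p ∈ ball (0 : X) ρ := hmem (by simpa using (norm_nonneg _).trans (hη 1))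
  have horb : Continuous fun t => α t p := hα.continuous_orbit p hpρ
  set p' := ∫ t, α t p ∂μ
  have hp' : ‖p' - p‖ ≤ η := norm_integral_sub_le (hint horb) hη
  refine ⟨p', hp', fun s => ?_⟩
  obtain ⟨D, -, hD⟩ := hα.quadApprox s p' (hmem hp')
  have hdev : Continuous fun t => α t p - p' := horb.sub continuous_const
  have hshift : Continuous fun t => α (s * t) p := horb.comp (continuous_const_mul s)
  have hDdev : Continuous fun t => D (α t p - p') := D.continuous.comp hdev
  have havg : ∫ t, (α (s * t) p - D (α t p - p')) ∂μ = p' := by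
    have hdev0 : ∫ t, (α t p - p') ∂μ = 0 := by
      rw [integral_sub (hint horb) (integrable_const _)]; simp [p']
    rw [integral_sub (hint hshift) (hint hDdev), integral_mul_left_eq_self (fun t => α t p) s,
      D.integral_comp_comm (hint hdev), hdev0, map_zero, sub_zero]
  have herr : ∀ t, ‖α (s * t) p - D (α t p - p') - α s p'‖ ≤ 4 * C * η ^ 2 := fun t => by
    have hdist : ‖α t p - p'‖ ≤ η + η := by
      rw [← sub_sub_sub_cancel_right _ _ p]
      exact (norm_sub_le _ _).trans (add_le_add (hη t) hp')
    calc ‖α (s * t) p - D (α t p - p') - α s p'‖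
        = ‖α s (α t p) - α s p' - D (α t p - p')‖ := by
          rw [hα.mul_apply s t p hpρ (hmem (hη t)), sub_right_comm]
      _ ≤ C * ‖α t p - p'‖ ^ 2 := hD _ (hmem (hη t))
      _ ≤ C * (η + η) ^ 2 := by gcongr
      _ = 4 * C * η ^ 2 := by ring
  calc ‖α s p' - p'‖ = ‖∫ t, (α (s * t) p - D (α t p - p')) ∂μ - α s p'‖ := by
        rw [havg, norm_sub_rev]
    _ ≤ 4 * C * η ^ 2 := norm_integral_sub_le (hint (hshift.sub hDdev)) herr

theorem IsQuadLocalAction.exists_fixed_point (hα : IsQuadLocalAction 𝕜 α ρ C) {δ : ℝ}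
    (hδ : ∀ s, ‖α s 0‖ ≤ δ) (hδρ : 2 * δ < ρ) (hδC : 8 * C * δ ≤ 1) :
    ∃ v : X, ‖v‖ ≤ 2 * δ ∧ ∀ s, α s v = v := by
  let P (η : ℝ) (p : X) : Prop := η ≤ δ ∧ ‖p‖ ≤ 2 * (δ - η) ∧ ∀ s, ‖α s p - p‖ ≤ η
  have step : ∀ η p, P η p → ∃ p', dist p p' ≤ η ∧ P (η / 2) p' := by
    rintro η p ⟨hηδ, hp, hη⟩
    have hη0 : 0 ≤ η := (norm_nonneg _).trans (hη 1)
    obtain ⟨p', hpp', hp'⟩ := hα.exists_displacement_le hη (by linarith)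
    refine ⟨p', by rwa [dist_comm, dist_eq_norm], by linarith, ?_, fun s => (hp' s).trans ?_⟩
    · linarith [norm_le_norm_add_norm_sub' p' p]
    · calc 4 * C * η ^ 2 = 8 * C * η * η / 2 := by ring
        _ ≤ 8 * C * δ * η / 2 := by gcongr
        _ ≤ η / 2 := by gcongr; exact mul_le_of_le_one_left hη0 hδC
  obtain ⟨u, v, huv, hu⟩ := exists_seq_tendsto_of_halving step
    (show P δ 0 from ⟨le_rfl, by simp, by simpa using hδ⟩)
  have hpow : Tendsto (fun n : ℕ => δ / 2 ^ n) atTop (𝓝 0) :=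
    tendsto_const_nhds.div_atTop (tendsto_pow_atTop_atTop_of_one_lt one_lt_two)
  have hv : ‖v‖ ≤ 2 * (δ - 0) :=
    le_of_tendsto_of_tendsto' huv.norm ((hpow.const_sub δ).const_mul 2) fun n => (hu n).2.1
  rw [sub_zero] at hv
  refine ⟨v, hv, fun s => ?_⟩
  have hcont : ContinuousAt (α s) v := (hα.quadApprox s).continuousOn.continuousAt
    (isOpen_ball.mem_nhds (mem_ball_zero_iff.2 (hv.trans_lt hδρ)))
  have hlim : Tendsto (fun n => α s (u n) - u n) atTop (𝓝 (α s v - v)) :=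
    (hcont.tendsto.comp huv).sub huv
  exact sub_eq_zero.1 (tendsto_nhds_unique hlim
    (squeeze_zero_norm (fun n => (hu n).2.2 s) hpow))

end FixedPoint

section Continuation

theorem eventually_nhdsGT_zero_mul_lt (c : ℝ) {b : ℝ} (hb : 0 < b) :
    ∀ᶠ x in 𝓝[>] (0 : ℝ), c * x < b :=
  ((continuous_const_mul c).continuousAt.eventually_lt_const (by simpa using hb)).filter_mono
    nhdsWithin_le_nhds

theorem mapsTo_Icc_of_forall_Ico {Y : Type*} [TopologicalSpace Y] {V : Set Y} (hV : IsOpen V)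
    {γ : ℝ → Y} {a b : ℝ} (hγ : ContinuousOn γ (Icc a b))
    (h : ∀ t ∈ Icc a b, (∀ s ∈ Ico a t, γ s ∈ V) → γ t ∈ V) : MapsTo γ (Icc a b) V := by
  intro t ht
  by_contra htV
  have hcomp : IsCompact (Icc a b ∩ γ ⁻¹' Vᶜ) := isCompact_Icc.of_isClosed_subset
    (hγ.preimage_isClosed_of_isClosed isClosed_Icc hV.isClosed_compl) inter_subset_left
  obtain ⟨t₀, ⟨ht₀, ht₀V⟩, hleast⟩ := hcomp.exists_isLeast ⟨t, ht, htV⟩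
  refine ht₀V (h t₀ ht₀ fun s hs => ?_)
  by_contra hsV
  exact (hleast ⟨⟨hs.1, hs.2.le.trans ht₀.2⟩, hsV⟩).not_gt hs.2

variable {𝕜 : Type*} [RCLike 𝕜] {X Y : Type*} [NormedAddCommGroup X] [NormedSpace 𝕜 X]
  [NormedAddCommGroup Y] [NormedSpace 𝕜 Y] {U : Type*} [TopologicalSpace U]

theorem exists_isClosed_preimage_closedBall [RegularSpace U] (κ : OpenPartialHomeomorph U Y)
    {x : U} (hx : x ∈ κ.source) :
    ∃ R > 0, ∀ ρ < R, IsClosed (κ.source ∩ κ ⁻¹' closedBall (κ x) ρ) := by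
  obtain ⟨N, hN, hNc, hNs⟩ := exists_mem_nhds_isClosed_subset (κ.open_source.mem_nhds hx)
  obtain ⟨R, hR, hRN⟩ : ∃ R > 0, ∀ y ∈ ball (κ x) R, y ∈ κ.target ∧ κ.symm y ∈ N :=
    eventually_nhds_iff_ball.1 (Eventually.and (κ.open_target.mem_nhds (κ.map_source hx))
      ((κ.symm.continuousAt (κ.map_source hx)).eventually (by rwa [κ.left_inv hx])))
  refine ⟨R, hR, fun ρ hρ => ?_⟩
  have hsub : κ.source ∩ κ ⁻¹' closedBall (κ x) ρ = N ∩ κ ⁻¹' closedBall (κ x) ρ := by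
    refine Subset.antisymm (fun y hy => ⟨?_, hy.2⟩) (inter_subset_inter_left _ hNs)
    simpa only [κ.left_inv hy.1] using (hRN _ (closedBall_subset_ball hρ hy.2)).2
  rw [hsub]
  exact (κ.continuousOn.mono hNs).preimage_isClosed_of_isClosed hNc isClosed_closedBall

theorem norm_image_sub_image_zero_le_of_forall_smul [NormedSpace ℝ X] {F : X → Y} {z : X} {L : ℝ}
    (h : ∀ θ ∈ Icc (0 : ℝ) 1, ∃ D : X →L[𝕜] Y, HasFDerivAt F D (θ • z) ∧ ‖D‖ ≤ L) :
    ‖F z - F 0‖ ≤ L * ‖z‖ := by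
  have hseg : ∀ x ∈ segment ℝ 0 z, ∃ D : X →L[𝕜] Y, HasFDerivAt F D x ∧ ‖D‖ ≤ L := by
    rw [segment_eq_image]
    rintro _ ⟨θ, hθ, rfl⟩
    simpa only [smul_zero, zero_add] using h θ hθ
  choose! D hD hDL using hseg
  simpa only [sub_zero] using (convex_segment 0 z).norm_image_sub_le_of_norm_hasFDerivWithin_le
    (fun x hx => (hD x hx).hasFDerivWithinAt) hDL (left_mem_segment ℝ _ _)
    (right_mem_segment ℝ _ _)

/-- The derivative bound confines `κ (f x)` to a ball smaller than the one where the bound is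
assumed, so `f` cannot leave the chart along a ray from `0`. -/
theorem mapsTo_ball_of_norm_hasFDerivAt_le {κ : OpenPartialHomeomorph U Y} {f : X → U} {r R : ℝ}
    {L : ℝ≥0} (hf : ContinuousOn f (ball 0 r)) (h0 : f 0 ∈ κ.source) (hκ0 : κ (f 0) = 0)
    (hcl : IsClosed (κ.source ∩ κ ⁻¹' closedBall 0 (L * r))) (hLr : L * r < R)
    (hderiv : ∀ x ∈ ball 0 r, f x ∈ κ.source ∩ κ ⁻¹' ball 0 R →
      ∃ D : X →L[𝕜] Y, HasFDerivAt (fun x => κ (f x)) D x ∧ ‖D‖ ≤ L) :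
    MapsTo f (ball 0 r) (κ.source ∩ κ ⁻¹' ball 0 R) := by
  let _ : NormedSpace ℝ X := NormedSpace.restrictScalars ℝ 𝕜 X
  intro y hy
  have hr : 0 < r := pos_of_mem_ball hy
  have hmem : ∀ t ∈ Icc (0 : ℝ) 1, t • y ∈ ball (0 : X) r := fun t ht =>
    (convex_ball (0 : X) r).smul_mem_of_zero_mem (mem_ball_self hr) hy ht
  suffices h : MapsTo (fun t : ℝ => f (t • y)) (Icc 0 1) (κ.source ∩ κ ⁻¹' ball 0 R) by
    simpa only [one_smul] using h (right_mem_Icc.2 zero_le_one)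
  have hcont : ContinuousOn (fun t : ℝ => f (t • y)) (Icc 0 1) := hf.comp (by fun_prop) hmem
  refine mapsTo_Icc_of_forall_Ico (κ.isOpen_inter_preimage isOpen_ball) hcont fun t ht hV => ?_
  rcases ht.1.eq_or_lt with rfl | ht0
  · simp only [zero_smul]
    exact ⟨h0, by rw [mem_preimage, hκ0]; exact mem_ball_self (hLr.trans_le' (by positivity))⟩
  have hbound : ∀ s ∈ Ico 0 t, f (s • y) ∈ κ.source ∩ κ ⁻¹' closedBall 0 (L * r) := by
    intro s hs
    have hmvt := norm_image_sub_image_zero_le_of_forall_smul (𝕜 := 𝕜) (F := fun x => κ (f x))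
      (z := s • y) (L := L) fun θ hθ => by
        have hθs : θ * s ∈ Ico 0 t :=
          ⟨mul_nonneg hθ.1 hs.1, (mul_le_of_le_one_left hs.1 hθ.2).trans_lt hs.2⟩
        rw [smul_smul]
        exact hderiv _ (hmem _ ⟨hθs.1, hθs.2.le.trans ht.2⟩) (hV _ hθs)
    rw [hκ0, sub_zero] at hmvt
    refine ⟨(hV s hs).1, mem_closedBall_zero_iff.2 (hmvt.trans ?_)⟩
    gcongr
    exact (mem_ball_zero_iff.1 (hmem s ⟨hs.1, hs.2.le.trans ht.2⟩)).le
  have hlim : f (t • y) ∈ κ.source ∩ κ ⁻¹' closedBall 0 (L * r) := by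
    refine hcl.closure_subset (((hcont t ht).mono fun s hs =>
      ⟨hs.1, hs.2.le.trans ht.2⟩).mem_closure (s := Ico 0 t) ?_ hbound)
    rw [closure_Ico ht0.ne]
    exact right_mem_Icc.2 ht0.le
  exact ⟨hlim.1, closedBall_subset_ball hLr hlim.2⟩

end Continuation

section Chart

variable {𝕜 : Type*} [RCLike 𝕜] {E : Type*} [NormedAddCommGroup E] [NormedSpace 𝕜 E]
  {U : Type*} [Group U] [TopologicalSpace U] [ChartedSpace E U]

variable (𝕜) in
/-- `κ` is a chart around the identity of the group `U`, sending `1` to `0`. It is only required to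
be compatible with the manifold structure at this point. -/
structure IsCenteredChart (κ : OpenPartialHomeomorph U E) : Prop where
  one_mem_source : 1 ∈ κ.source
  map_one : κ 1 = 0
  contMDiffAt : ContMDiffAt 𝓘(𝕜, E) 𝓘(𝕜, E) 2 κ 1
  contMDiffAt_symm : ContMDiffAt 𝓘(𝕜, E) 𝓘(𝕜, E) 2 κ.symm 0

/-- Conjugation by `g`, read in the chart `κ`. -/
def chartConj (κ : OpenPartialHomeomorph U E) (g : U) : E → E := fun y => κ (g * κ.symm y * g⁻¹)

theorem isCenteredChart_trans {χ : OpenPartialHomeomorph U E} {Φ : OpenPartialHomeomorph E E}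
    (h1 : 1 ∈ χ.source) (hχ : ContMDiffAt 𝓘(𝕜, E) 𝓘(𝕜, E) 2 χ 1)
    (hχs : ContMDiffAt 𝓘(𝕜, E) 𝓘(𝕜, E) 2 χ.symm (χ 1)) (h1Φ : χ 1 ∈ Φ.source)
    (hΦ0 : Φ (χ 1) = 0) (hΦ : ContDiffAt 𝕜 2 Φ (χ 1)) (hΦs : ContDiffAt 𝕜 2 Φ.symm 0) :
    IsCenteredChart 𝕜 (χ.trans Φ) where
  one_mem_source := by
    rw [OpenPartialHomeomorph.trans_source]
    exact ⟨h1, h1Φ⟩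
  map_one := hΦ0
  contMDiffAt := hΦ.contMDiffAt.comp 1 hχ
  contMDiffAt_symm := by
    refine ContMDiffAt.comp (g := χ.symm) (f := Φ.symm) 0 ?_ hΦs.contMDiffAt
    rwa [← hΦ0, Φ.left_inv h1Φ]

namespace IsCenteredChart

variable {κ : OpenPartialHomeomorph U E} (hκ : IsCenteredChart 𝕜 κ)
include hκ

theorem zero_mem_target : 0 ∈ κ.target := hκ.map_one ▸ κ.map_source hκ.one_mem_source

theorem symm_zero : κ.symm 0 = 1 := by rw [← hκ.map_one, κ.left_inv hκ.one_mem_source]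

theorem tendsto : Tendsto κ (𝓝 1) (𝓝 0) :=
  hκ.map_one ▸ (κ.continuousAt hκ.one_mem_source).tendsto

theorem tendsto_symm : Tendsto κ.symm (𝓝 0) (𝓝 1) :=
  hκ.symm_zero ▸ (κ.symm.continuousAt hκ.zero_mem_target).tendsto

theorem restrOpen {s : Set U} (hs : IsOpen s) (h1 : 1 ∈ s) :
    IsCenteredChart 𝕜 (κ.restrOpen s hs) where
  one_mem_source := ⟨hκ.one_mem_source, h1⟩
  map_one := hκ.map_one
  contMDiffAt := hκ.contMDiffAt
  contMDiffAt_symm := hκ.contMDiffAt_symm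

variable [LieGroup 𝓘(𝕜, E) 2 U]

theorem contDiffAt_mul :
    ContDiffAt 𝕜 2 (fun p : E × E => κ (κ.symm p.1 * κ.symm p.2)) (0, 0) := by
  refine contMDiffAt_iff_contDiffAt.1 (ContMDiffAt.comp (g := κ) (0, 0) ?_
    (ContMDiffAt.mul (f := fun p : E × E => κ.symm p.1) (g := fun p : E × E => κ.symm p.2)
      (hκ.contMDiffAt_symm.comp (0, 0) contDiff_fst.contMDiff.contMDiffAt)
      (hκ.contMDiffAt_symm.comp (0, 0) contDiff_snd.contMDiff.contMDiffAt)))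
  simpa only [hκ.symm_zero, mul_one] using hκ.contMDiffAt

theorem contDiffAt_inv_mul :
    ContDiffAt 𝕜 2 (fun p : E × E => κ ((κ.symm p.1)⁻¹ * κ.symm p.2)) (0, 0) := by
  refine contMDiffAt_iff_contDiffAt.1 (ContMDiffAt.comp (g := κ) (0, 0) ?_
    (ContMDiffAt.mul (f := fun p : E × E => (κ.symm p.1)⁻¹) (g := fun p : E × E => κ.symm p.2)
      (hκ.contMDiffAt_symm.comp (0, 0) contDiff_fst.contMDiff.contMDiffAt).inv
      (hκ.contMDiffAt_symm.comp (0, 0) contDiff_snd.contMDiff.contMDiffAt)))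
  simpa only [hκ.symm_zero, inv_one, mul_one] using hκ.contMDiffAt

theorem hasFDerivAt_mul :
    HasFDerivAt (fun p : E × E => κ (κ.symm p.1 * κ.symm p.2))
      (ContinuousLinearMap.fst 𝕜 E E + ContinuousLinearMap.snd 𝕜 E E) (0, 0) := by
  have hT := (hκ.contDiffAt_mul.differentiableAt (by simp)).hasFDerivAt
  set T := fderiv 𝕜 (fun p : E × E => κ (κ.symm p.1 * κ.symm p.2)) (0, 0)
  have htarget : ∀ᶠ y in 𝓝 0, y ∈ κ.target := κ.open_target.mem_nhds hκ.zero_mem_target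
  have hinl : T ∘L ContinuousLinearMap.inl 𝕜 E E = ContinuousLinearMap.id 𝕜 E := by
    refine (HasFDerivAt.comp (f := fun y : E => (y, (0 : E))) 0 hT
      (hasFDerivAt_prodMk_left 0 0)).unique ((hasFDerivAt_id 0).congr_of_eventuallyEq ?_)
    filter_upwards [htarget] with y hy
    simp [hκ.symm_zero, κ.right_inv hy]
  have hinr : T ∘L ContinuousLinearMap.inr 𝕜 E E = ContinuousLinearMap.id 𝕜 E := by
    refine (HasFDerivAt.comp (f := fun y : E => ((0 : E), y)) 0 hT
      (hasFDerivAt_prodMk_right 0 0)).unique ((hasFDerivAt_id 0).congr_of_eventuallyEq ?_)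
    filter_upwards [htarget] with y hy
    simp [hκ.symm_zero, κ.right_inv hy]
  refine hT.congr_fderiv (ContinuousLinearMap.ext fun p => ?_)
  calc T p = (T ∘L ContinuousLinearMap.inl 𝕜 E E) p.1
        + (T ∘L ContinuousLinearMap.inr 𝕜 E E) p.2 := by simp [← map_add]
    _ = p.1 + p.2 := by rw [hinl, hinr]; rfl

theorem exists_hasFDerivAt_chartConj_zero :
    ∃ M : ℝ≥0, ∀ g : U, ∃ D : E →L[𝕜] E, ‖D‖ ≤ M * ‖Ad 𝕜 E g‖ ∧
      HasFDerivAt (chartConj κ g) D 0 := by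
  let D₁ : E →L[𝕜] E := mfderiv 𝓘(𝕜, E) 𝓘(𝕜, E) κ 1
  let D₂ : E →L[𝕜] E := mfderiv 𝓘(𝕜, E) 𝓘(𝕜, E) κ.symm 0
  refine ⟨‖D₁‖₊ * ‖D₂‖₊, fun g => ⟨D₁ ∘L Ad 𝕜 E g ∘L D₂, ?_, ?_⟩⟩
  · calc ‖D₁ ∘L Ad 𝕜 E g ∘L D₂‖ ≤ ‖D₁‖ * (‖Ad 𝕜 E g‖ * ‖D₂‖) :=
          (ContinuousLinearMap.opNorm_comp_le _ _).trans
            (mul_le_mul_of_nonneg_left (ContinuousLinearMap.opNorm_comp_le _ _) (norm_nonneg _))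
      _ = ‖D₁‖ * ‖D₂‖ * ‖Ad 𝕜 E g‖ := by ring
  have hD₁ : HasMFDerivAt 𝓘(𝕜, E) 𝓘(𝕜, E) κ (g * κ.symm 0 * g⁻¹) D₁ := by
    rw [hκ.symm_zero, mul_one, mul_inv_cancel]
    exact (hκ.contMDiffAt.mdifferentiableAt (by simp)).hasMFDerivAt
  have hD₂ : HasMFDerivAt 𝓘(𝕜, E) 𝓘(𝕜, E) κ.symm 0 D₂ :=
    (hκ.contMDiffAt_symm.mdifferentiableAt (by simp)).hasMFDerivAt
  have hconj : ContMDiff 𝓘(𝕜, E) 𝓘(𝕜, E) 2 fun x : U => g * x * g⁻¹ :=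
    (contMDiff_const.mul contMDiff_id).mul contMDiff_const
  have hAd : HasMFDerivAt 𝓘(𝕜, E) 𝓘(𝕜, E) (fun x : U => g * x * g⁻¹) (κ.symm 0) (Ad 𝕜 E g) := by
    rw [hκ.symm_zero]
    exact ((hconj 1).mdifferentiableAt (by simp)).hasMFDerivAt
  exact hasMFDerivAt_iff_hasFDerivAt.1 (HasMFDerivAt.comp (g := κ) 0 hD₁
    (HasMFDerivAt.comp (f := κ.symm) 0 hAd hD₂))

theorem exists_hasFDerivAt_translation :
    ∃ P Q : E → E →L[𝕜] E, ContDiffAt 𝕜 1 P 0 ∧ ContDiffAt 𝕜 1 Q 0 ∧ ∀ᶠ x in 𝓝 0,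
      HasFDerivAt (fun y => κ (κ.symm x * κ.symm y)) (P x) 0 ∧
      HasFDerivAt (fun y => κ ((κ.symm x)⁻¹ * κ.symm y)) (Q x) x := by
  have hm : ∀ᶠ x : E in 𝓝 0,
      ContDiffAt 𝕜 2 (fun p : E × E => κ (κ.symm p.1 * κ.symm p.2)) (x, 0) :=
    (Continuous.prodMk_left (0 : E)).continuousAt.eventually
      (hκ.contDiffAt_mul.eventually (by simp))
  have hn : ∀ᶠ x : E in 𝓝 0,
      ContDiffAt 𝕜 2 (fun p : E × E => κ ((κ.symm p.1)⁻¹ * κ.symm p.2)) (x, x) :=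
    (continuous_id.prodMk continuous_id).continuousAt.eventually
      (hκ.contDiffAt_inv_mul.eventually (by simp))
  refine ⟨fun x => fderiv 𝕜 (fun y => κ (κ.symm x * κ.symm y)) 0,
    fun x => fderiv 𝕜 (fun y => κ ((κ.symm x)⁻¹ * κ.symm y)) x,
    ContDiffAt.fderiv hκ.contDiffAt_mul contDiffAt_const (by norm_num),
    ContDiffAt.fderiv hκ.contDiffAt_inv_mul contDiffAt_id (by norm_num), ?_⟩
  filter_upwards [hm, hn] with x hmx hnx
  exact ⟨((hmx.comp 0 (contDiffAt_const.prodMk contDiffAt_id)).differentiableAt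
      (by simp)).hasFDerivAt,
    ((hnx.comp x (contDiffAt_const.prodMk contDiffAt_id)).differentiableAt (by simp)).hasFDerivAt⟩

end IsCenteredChart

end Chart

theorem lipschitzOnWith_quadApprox_of_hasFDerivAt_comp {𝕜 E : Type*} [RCLike 𝕜]
    [NormedAddCommGroup E] [NormedSpace 𝕜 E] {c : E → E} {P Q : E → E →L[𝕜] E} {D : E →L[𝕜] E}
    {a : E} {r : ℝ} {s : Set E} {p q A : ℝ≥0}
    (hc : ∀ x ∈ ball a r, HasFDerivAt c (P (c x) ∘L D ∘L Q x) x) (hcs : MapsTo c (ball a r) s)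
    (hP : LipschitzOnWith p P s) (hPb : ∀ x ∈ s, ‖P x‖ ≤ p)
    (hQ : LipschitzOnWith q Q (ball a r)) (hQb : ∀ x ∈ ball a r, ‖Q x‖ ≤ q) (hD : ‖D‖ ≤ A) :
    LipschitzOnWith (p * (A * q)) c (ball a r) ∧
      QuadApprox 𝕜 c (ball a r) ((p * (A * q)) ^ 2 + p * (A * q)) := by
  let _ : NormedSpace ℝ E := NormedSpace.restrictScalars ℝ 𝕜 E
  have hDQ : ∀ x ∈ ball a r, ‖D ∘L Q x‖ ≤ ↑(A * q) := fun x hx =>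
    (D.opNorm_comp_le _).trans (by push_cast; gcongr; exact hQb x hx)
  have hPDQ : ∀ x ∈ ball a r, ‖P (c x) ∘L D ∘L Q x‖ ≤ ↑(p * (A * q)) := fun x hx =>
    ((P (c x)).opNorm_comp_le _).trans
      (mul_le_mul (hPb _ (hcs hx)) (hDQ x hx) (norm_nonneg _) p.2)
  have hcL : LipschitzOnWith (p * (A * q)) c (ball a r) :=
    (convex_ball a r).lipschitzOnWith_of_nnnorm_hasFDerivWithin_le
      (fun x hx => (hc x hx).hasFDerivWithinAt) hPDQ
  have hDQL : LipschitzOnWith (0 * q + A * q) (fun x => D ∘L Q x) (ball a r) :=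
    lipschitzOnWith_clm_comp (LipschitzWith.const D).lipschitzOnWith (fun _ _ => hD) hQ hQb
  have hderivL : LipschitzOnWith (p * (p * (A * q)) * (A * q) + p * (0 * q + A * q))
      (fun x => P (c x) ∘L D ∘L Q x) (ball a r) :=
    lipschitzOnWith_clm_comp (hP.comp hcL hcs) (fun x hx => hPb _ (hcs hx)) hDQL hDQ
  refine ⟨hcL, quadApprox_of_hasFDerivAt hc (fun x hx => (hPDQ x hx).trans ?_)
    (hderivL.weaken (le_of_eq (by ring)))⟩
  exact_mod_cast le_add_self

namespace IsCenteredChart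

variable {𝕜 : Type*} [RCLike 𝕜] {E : Type*} [NormedAddCommGroup E] [NormedSpace 𝕜 E]
  {U : Type*} [Group U] [TopologicalSpace U] [ChartedSpace E U]
  {κ : OpenPartialHomeomorph U E} (hκ : IsCenteredChart 𝕜 κ)
include hκ

theorem chartConj_zero (g : U) : chartConj κ g 0 = 0 := by
  rw [chartConj, hκ.symm_zero, mul_one, mul_inv_cancel, hκ.map_one]

/-- With `c = chartConj κ g`, near `x` we have `c y = κ (κ⁻¹ (c x) * κ⁻¹ (c (n y)))` where
`n y = κ ((κ⁻¹ x)⁻¹ * κ⁻¹ y)` vanishes at `x`. -/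
theorem hasFDerivAt_chartConj [IsTopologicalGroup U] {g : U} {x : E} {D P Q : E →L[𝕜] E}
    (hx : x ∈ κ.target) (hgx : g * κ.symm x * g⁻¹ ∈ κ.source)
    (hD : HasFDerivAt (chartConj κ g) D 0)
    (hP : HasFDerivAt (fun y => κ (κ.symm (chartConj κ g x) * κ.symm y)) P 0)
    (hQ : HasFDerivAt (fun y => κ ((κ.symm x)⁻¹ * κ.symm y)) Q x) :
    HasFDerivAt (chartConj κ g) (P ∘L D ∘L Q) x := by
  have hnx : κ ((κ.symm x)⁻¹ * κ.symm x) = 0 := by rw [inv_mul_cancel, hκ.map_one]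
  rw [← hnx] at hD
  have hcn := hD.comp x hQ
  rw [← hκ.chartConj_zero g, ← hnx] at hP
  refine (hP.comp x hcn).congr_of_eventuallyEq ?_
  have hn : Tendsto (fun y => (κ.symm x)⁻¹ * κ.symm y) (𝓝 x) (𝓝 1) := by
    simpa only [inv_mul_cancel] using (κ.symm.continuousAt hx).tendsto.const_mul (κ.symm x)⁻¹
  have hgn : Tendsto (fun y => g * ((κ.symm x)⁻¹ * κ.symm y) * g⁻¹) (𝓝 x) (𝓝 1) := by
    simpa only [mul_one, mul_inv_cancel] using (hn.const_mul g).mul_const g⁻¹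
  have hsource : κ.source ∈ 𝓝 1 := κ.open_source.mem_nhds hκ.one_mem_source
  filter_upwards [hn.eventually hsource, hgn.eventually hsource] with y hny hgny
  simp only [Function.comp_apply, chartConj, κ.left_inv hny, κ.left_inv hgny, κ.left_inv hgx]
  group

variable [LieGroup 𝓘(𝕜, E) 2 U]

theorem exists_hasFDerivAt_chartConj :
    ∃ (P Q : E → E →L[𝕜] E) (p q : ℝ≥0), ∃ R > 0, ball 0 R ⊆ κ.target ∧
      LipschitzOnWith p P (ball 0 R) ∧ (∀ x ∈ ball 0 R, ‖P x‖ ≤ p) ∧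
      LipschitzOnWith q Q (ball 0 R) ∧ (∀ x ∈ ball 0 R, ‖Q x‖ ≤ q) ∧
      ∀ g : U, ∀ D : E →L[𝕜] E, HasFDerivAt (chartConj κ g) D 0 →
        ∀ x ∈ ball 0 R, g * κ.symm x * g⁻¹ ∈ κ.source ∩ κ ⁻¹' ball 0 R →
          HasFDerivAt (chartConj κ g) (P (chartConj κ g x) ∘L D ∘L Q x) x := by
  have := topologicalGroup_of_lieGroup 𝓘(𝕜, E) (G := U) 2
  obtain ⟨P, Q, hP, hQ, hPQ⟩ := hκ.exists_hasFDerivAt_translation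
  obtain ⟨p, s, hs, hPL, hPb⟩ := exists_lipschitzOnWith_norm_le hP
  obtain ⟨q, t, ht, hQL, hQb⟩ := exists_lipschitzOnWith_norm_le hQ
  have htarget : κ.target ∈ 𝓝 0 := κ.open_target.mem_nhds hκ.zero_mem_target
  obtain ⟨R, hR, hball⟩ := eventually_nhds_iff_ball.1
    (hPQ.and (inter_mem htarget (inter_mem hs ht)))
  exact ⟨P, Q, p, q, R, hR, fun x hx => (hball x hx).2.1, hPL.mono fun x hx => (hball x hx).2.2.1,
    fun x hx => hPb x (hball x hx).2.2.1, hQL.mono fun x hx => (hball x hx).2.2.2,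
    fun x hx => hQb x (hball x hx).2.2.2, fun g D hD x hx hgx =>
      hκ.hasFDerivAt_chartConj (hball x hx).2.1 hgx.1 hD (hball _ hgx.2).1.1 (hball x hx).1.2⟩

theorem exists_quadApprox_chartConj (C : ℝ) :
    ∃ r > 0, ∃ L : ℝ≥0, ∀ g : U, ‖Ad 𝕜 E g‖ ≤ C →
      (∀ y ∈ ball 0 r, g * κ.symm y * g⁻¹ ∈ κ.source) ∧
      LipschitzOnWith L (chartConj κ g) (ball 0 r) ∧
      QuadApprox 𝕜 (chartConj κ g) (ball 0 r) L := by
  have := topologicalGroup_of_lieGroup 𝓘(𝕜, E) (G := U) 2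
  obtain ⟨M, hM⟩ := hκ.exists_hasFDerivAt_chartConj_zero
  obtain ⟨P, Q, p, q, R, hR, htarget, hPL, hPb, hQL, hQb, hderiv⟩ :=
    hκ.exists_hasFDerivAt_chartConj
  obtain ⟨R', hR', hclosed⟩ := exists_isClosed_preimage_closedBall κ hκ.one_mem_source
  rw [hκ.map_one] at hclosed
  let A : ℝ≥0 := (M * C).toNNReal
  let L := p * (A * q)
  obtain ⟨r, hLr, hr⟩ :=
    ((eventually_nhdsGT_zero_mul_lt L (lt_min hR hR')).and (Ioo_mem_nhdsGT hR)).exists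
  have hrR : ball (0 : E) r ⊆ ball 0 R := ball_subset_ball hr.2.le
  refine ⟨r, hr.1, L ^ 2 + L, fun g hg => ?_⟩
  obtain ⟨D, hDM, hD⟩ := hM g
  have hDA : ‖D‖ ≤ A :=
    hDM.trans ((mul_le_mul_of_nonneg_left hg M.2).trans (Real.le_coe_toNNReal _))
  have hcont : ContinuousOn (fun y => g * κ.symm y * g⁻¹) (ball 0 r) :=
    (continuousOn_const.mul (κ.symm.continuousOn.mono (hrR.trans htarget))).mul continuousOn_const
  have hmaps : MapsTo (fun y => g * κ.symm y * g⁻¹) (ball 0 r) (κ.source ∩ κ ⁻¹' ball 0 R) := by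
    refine mapsTo_ball_of_norm_hasFDerivAt_le hcont
      (by simpa [hκ.symm_zero] using hκ.one_mem_source) (hκ.chartConj_zero g)
      (hclosed _ (hLr.trans_le (min_le_right _ _))) (hLr.trans_le (min_le_left _ _))
      fun x hx hgx => ⟨_, hderiv g D hD x (hrR hx) hgx, ?_⟩
    calc ‖P (chartConj κ g x) ∘L D ∘L Q x‖ ≤ ‖P (chartConj κ g x)‖ * (‖D‖ * ‖Q x‖) :=
          (ContinuousLinearMap.opNorm_comp_le _ _).trans
            (mul_le_mul_of_nonneg_left (D.opNorm_comp_le _) (norm_nonneg _))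
      _ ≤ p * (A * q) := by
          gcongr
          exacts [hPb _ hgx.2, hQb x (hrR hx)]
  obtain ⟨hL, hquad⟩ := lipschitzOnWith_quadApprox_of_hasFDerivAt_comp
    (fun x hx => hderiv g D hD x (hrR hx) (hmaps hx)) (fun x hx => (hmaps hx).2) hPL hPb
    (hQL.mono hrR) (fun x hx => hQb x (hrR hx)) hDA
  exact ⟨fun y hy => (hmaps hy).1, hL.weaken le_add_self, hquad⟩

theorem eventually_conj_mem {V : Set U} (hV : V ∈ 𝓝 1) (C : ℝ) :
    ∀ᶠ x in 𝓝 (1 : U), ∀ g : U, ‖Ad 𝕜 E g‖ ≤ C → g * x * g⁻¹ ∈ V := by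
  obtain ⟨r, hr, L, hconj⟩ := hκ.exists_quadApprox_chartConj C
  obtain ⟨η, hη, hηV⟩ : ∃ η > 0, ∀ y ∈ ball 0 η, κ.symm y ∈ V :=
    eventually_nhds_iff_ball.1 (hκ.tendsto_symm hV)
  have hlim : Tendsto (fun x => L * ‖κ x‖) (𝓝 1) (𝓝 0) := by
    simpa using hκ.tendsto.norm.const_mul (L : ℝ)
  filter_upwards [κ.open_source.mem_nhds hκ.one_mem_source, hκ.tendsto (ball_mem_nhds 0 hr),
    hlim.eventually_lt_const hη] with x hx hxr hxη g hg
  obtain ⟨hsource, hL, -⟩ := hconj g hg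
  have hgx := hsource _ hxr
  have hle := hL.norm_sub_le hxr (mem_ball_self hr)
  rw [hκ.chartConj_zero, sub_zero, sub_zero, chartConj, κ.left_inv hx] at hle
  rw [κ.left_inv hx] at hgx
  simpa only [κ.left_inv hgx] using hηV _ (mem_ball_zero_iff.2 (hle.trans_lt hxη))

end IsCenteredChart

section AdaptedChart

variable {𝕜 : Type*} [RCLike 𝕜] {E : Type*} [NormedAddCommGroup E] [NormedSpace 𝕜 E]
  {U : Type*} [Group U] [TopologicalSpace U] [ChartedSpace E U]

variable (𝕜) in
/-- The chart `κ` is adapted to the subgroup `G` through the projection `π`: the left cosets of `G`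
are the fibres of `π` in this chart, so that `ker π` is a model of `G` and `range π` one of `U ⧸ G`,
both near the identity. -/
structure IsAdaptedChart (κ : OpenPartialHomeomorph U E) (π : E →L[𝕜] E) (G : Subgroup U) : Prop
    extends IsCenteredChart 𝕜 κ where
  proj_proj : ∀ v, π (π v) = π v
  inv_mul_mem_iff : ∀ x ∈ κ.source, ∀ y ∈ κ.source, x⁻¹ * y ∈ G ↔ π (κ x) = π (κ y)

theorem exists_isCenteredChart_mem_iff {G : Subgroup U}
    {χ : OpenPartialHomeomorph U E} (hχ : χ ∈ IsManifold.maximalAtlas 𝓘(𝕜, E) 2 U)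
    (h1 : 1 ∈ χ.source) {F : Submodule 𝕜 E} (hF : F.ClosedComplemented)
    (hG : ∀ x ∈ χ.source, x ∈ G ↔ χ x ∈ F) :
    ∃ (κ : OpenPartialHomeomorph U E) (π : E →L[𝕜] E), IsCenteredChart 𝕜 κ ∧
      (∀ v, π (π v) = π v) ∧ ∀ x ∈ κ.source, x ∈ G ↔ π (κ x) = 0 := by
  obtain ⟨P, hP⟩ := hF
  let π : E →L[𝕜] E := ContinuousLinearMap.id 𝕜 E - F.subtypeL ∘L P
  have hπ : ∀ v, π v = 0 ↔ v ∈ F := fun v => by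
    refine ⟨fun hv => ?_, fun hv => ?_⟩
    · rw [sub_eq_zero.1 (show v - P v = 0 from hv)]
      exact (P v).2
    · simp [π, hP ⟨v, hv⟩]
  have h1F : χ 1 ∈ F := (hG 1 h1).1 G.one_mem
  let τ : OpenPartialHomeomorph E E := (Homeomorph.addRight (-χ 1)).toOpenPartialHomeomorph
  refine ⟨χ.trans τ, π, isCenteredChart_trans h1 (contMDiffAt_of_mem_maximalAtlas hχ h1)
    (contMDiffAt_symm_of_mem_maximalAtlas hχ (χ.map_source h1)) (mem_univ _)
    (add_neg_cancel _) (contDiffAt_id.add contDiffAt_const)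
    (contDiffAt_id.add contDiffAt_const), fun v => by simp [π, hP (P v)], fun x hx => ?_⟩
  rw [OpenPartialHomeomorph.trans_source] at hx
  rw [hG x hx.1, hπ]
  exact (F.add_mem_iff_left (F.neg_mem h1F)).symm

section

variable {κ κ' : OpenPartialHomeomorph U E} (hκ : IsCenteredChart 𝕜 κ)
  (hκ' : IsCenteredChart 𝕜 κ') {π : E →L[𝕜] E}
  (hmul : ∀ᶠ w in 𝓝 0, κ'.symm w = κ.symm (π w) * κ.symm (w - π w))
include hκ hκ' hmul

theorem IsCenteredChart.eventually_inv_symm_proj_mul :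
    ∀ᶠ x in 𝓝 1, κ' x - π (κ' x) ∈ κ.target ∧
      (κ.symm (π (κ' x)))⁻¹ * x = κ.symm (κ' x - π (κ' x)) := by
  have hsub : Tendsto (fun w => w - π w) (𝓝 0) (𝓝 0) :=
    (continuous_id.sub π.continuous).tendsto' 0 0 (by simp)
  filter_upwards [κ'.open_source.mem_nhds hκ'.one_mem_source, hκ'.tendsto.eventually hmul,
    (hsub.comp hκ'.tendsto).eventually (κ.open_target.mem_nhds hκ.zero_mem_target)]
    with x hx hxmul hxt
  exact ⟨hxt, by rw [inv_mul_eq_iff_eq_mul, ← hxmul, κ'.left_inv hx]⟩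

theorem IsCenteredChart.eventually_proj_eq [LieGroup 𝓘(𝕜, E) 2 U]
    (hπ : ∀ v, π (π v) = π v) :
    ∀ᶠ p in 𝓝 (1 : U) ×ˢ 𝓝 (1 : U),
      let v := π (κ' p.1)
      let h := (κ.symm v)⁻¹ * p.2
      h ∈ κ.source ∧ (π (κ h) = 0 → π (κ' p.2) = v) := by
  have := topologicalGroup_of_lieGroup 𝓘(𝕜, E) (G := U) 2
  have hv : Tendsto (fun p : U × U => π (κ' p.1)) (𝓝 1 ×ˢ 𝓝 1) (𝓝 0) :=
    (π.continuous.tendsto' 0 0 (map_zero π)).comp (hκ'.tendsto.comp tendsto_fst)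
  have hh : Tendsto (fun p : U × U => (κ.symm (π (κ' p.1)))⁻¹ * p.2) (𝓝 1 ×ˢ 𝓝 1) (𝓝 1) := by
    simpa using (hκ.tendsto_symm.comp hv).inv.mul tendsto_snd
  have hw : Tendsto (fun p : U × U => π (κ' p.1) + κ ((κ.symm (π (κ' p.1)))⁻¹ * p.2))
      (𝓝 1 ×ˢ 𝓝 1) (𝓝 0) := by
    simpa using hv.add (hκ.tendsto.comp hh)
  filter_upwards [hh.eventually_mem (κ.open_source.mem_nhds hκ.one_mem_source),
    hw.eventually hmul, hw.eventually_mem (κ'.open_target.mem_nhds hκ'.zero_mem_target)]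
    with ⟨x, y⟩ hh hw hwt
  refine ⟨hh, fun hπh => ?_⟩
  have hπw : π (π (κ' x) + κ ((κ.symm (π (κ' x)))⁻¹ * y)) = π (κ' x) := by
    rw [map_add, hπ, hπh, add_zero]
  dsimp only at hh hw hwt
  rw [hπw, add_sub_cancel_left, κ.left_inv hh, mul_inv_cancel_left] at hw
  rw [← hw, κ'.right_inv hwt, hπw]

end

variable [LieGroup 𝓘(𝕜, E) 2 U]

theorem IsCenteredChart.exists_symm_eq_mul [CompleteSpace E] {κ : OpenPartialHomeomorph U E}
    (hκ : IsCenteredChart 𝕜 κ) (π : E →L[𝕜] E) :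
    ∃ κ' : OpenPartialHomeomorph U E, IsCenteredChart 𝕜 κ' ∧
      ∀ᶠ w in 𝓝 0, κ'.symm w = κ.symm (π w) * κ.symm (w - π w) := by
  have := topologicalGroup_of_lieGroup 𝓘(𝕜, E) (G := U) 2
  let Θ : E → E := fun w => κ (κ.symm (π w) * κ.symm (w - π w))
  have hlin : ContDiff 𝕜 2 fun w : E => (π w, w - π w) :=
    π.contDiff.prodMk (contDiff_id.sub π.contDiff)
  have hlin0 : (π 0, 0 - π 0) = ((0 : E), (0 : E)) := by simp
  have hΘ0 : Θ 0 = 0 := by simp [Θ, hκ.symm_zero, hκ.map_one]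
  have hΘc : ContDiffAt 𝕜 2 Θ 0 :=
    ContDiffAt.comp (g := fun p : E × E => κ (κ.symm p.1 * κ.symm p.2)) 0
      (hlin0 ▸ hκ.contDiffAt_mul) hlin.contDiffAt
  have hΘd : HasFDerivAt Θ (ContinuousLinearEquiv.refl 𝕜 E : E →L[𝕜] E) 0 := by
    refine (HasFDerivAt.comp (g := fun p : E × E => κ (κ.symm p.1 * κ.symm p.2)) 0
      (hlin0 ▸ hκ.hasFDerivAt_mul)
      (π.hasFDerivAt.prodMk ((hasFDerivAt_id 0).sub π.hasFDerivAt))).congr_fderiv ?_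
    ext v
    simp
  let Φ : OpenPartialHomeomorph E E := hΘc.toOpenPartialHomeomorph Θ hΘd two_ne_zero
  have h0 : 0 ∈ Φ.source := hΘc.mem_toOpenPartialHomeomorph_source hΘd two_ne_zero
  have hΦ0 : Φ 0 = 0 := hΘ0
  have hΦs0 : Φ.symm 0 = 0 := by simpa only [hΦ0] using Φ.left_inv h0
  have hΦs : ContDiffAt 𝕜 2 Φ.symm 0 := hΘ0 ▸ hΘc.to_localInverse hΘd two_ne_zero
  refine ⟨κ.trans Φ.symm, isCenteredChart_trans hκ.one_mem_source hκ.contMDiffAt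
    (hκ.map_one ▸ hκ.contMDiffAt_symm) ?_ ?_ (hκ.map_one ▸ hΦs) hΘc, ?_⟩
  · rw [hκ.map_one, ← hΦ0]; exact Φ.map_source h0
  · rw [hκ.map_one, hΦs0]
  have hprod : Tendsto (fun w => κ.symm (π w) * κ.symm (w - π w)) (𝓝 0) (𝓝 1) := by
    have hlim := hlin.continuous.tendsto (0 : E)
    rw [hlin0, nhds_prod_eq] at hlim
    simpa using (hκ.tendsto_symm.comp (tendsto_fst.comp hlim)).mul
      (hκ.tendsto_symm.comp (tendsto_snd.comp hlim))
  filter_upwards [hprod.eventually (κ.open_source.mem_nhds hκ.one_mem_source)] with w hw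
  exact κ.left_inv hw

/-- The new chart is `(v, f) ↦ κ⁻¹ v * κ⁻¹ f` on `range π × ker π`: right multiplication by
elements of `G` near `1` only changes `f`. -/
theorem exists_isAdaptedChart [CompleteSpace E] {κ : OpenPartialHomeomorph U E}
    (hκ : IsCenteredChart 𝕜 κ) {π : E →L[𝕜] E} (hπ : ∀ v, π (π v) = π v) {G : Subgroup U}
    (hG : ∀ x ∈ κ.source, x ∈ G ↔ π (κ x) = 0) :
    ∃ κ' : OpenPartialHomeomorph U E, IsAdaptedChart 𝕜 κ' π G := by
  obtain ⟨κ', hκ', hmul⟩ := hκ.exists_symm_eq_mul π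
  have hfibre : ∀ᶠ x in 𝓝 1, (κ.symm (π (κ' x)))⁻¹ * x ∈ G := by
    filter_upwards [hκ.eventually_inv_symm_proj_mul hκ' hmul] with x hx
    rw [hx.2, hG _ (κ.map_target hx.1), κ.right_inv hx.1, map_sub, hπ, sub_self]
  have hiff : ∀ᶠ p in 𝓝 (1 : U) ×ˢ 𝓝 (1 : U), p.1⁻¹ * p.2 ∈ G ↔ π (κ' p.1) = π (κ' p.2) := by
    filter_upwards [tendsto_fst.eventually hfibre, tendsto_snd.eventually hfibre,
      hκ.eventually_proj_eq hκ' hmul hπ] with ⟨x, y⟩ hx hy hxy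
    refine ⟨fun h => (hxy.2 ((hG _ hxy.1).1 ?_)).symm, fun h => ?_⟩
    · simpa [mul_assoc] using G.mul_mem hx h
    · simpa [h, mul_assoc] using G.mul_mem (G.inv_mem hx) hy
  obtain ⟨s, hs, hiff⟩ := (eventually_prod_self_iff
    (r := fun x y => x⁻¹ * y ∈ G ↔ π (κ' x) = π (κ' y))).1 hiff
  obtain ⟨o, hos, ho, h1o⟩ := mem_nhds_iff.1 hs
  exact ⟨κ'.restrOpen o ho, hκ'.restrOpen ho h1o, hπ,
    fun x hx y hy => hiff x (hos hx.2) y (hos hy.2)⟩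

end AdaptedChart

section CosetTranslation

variable {𝕜 : Type*} [RCLike 𝕜] {E : Type*} [NormedAddCommGroup E] [NormedSpace 𝕜 E]
  {U : Type*} [Group U] [TopologicalSpace U] [ChartedSpace E U]

/-- `a` is the left translation by `g` on `U ⧸ G`, read in a chart `κ` adapted to `G` through `π`:
on the ball of radius `ρ`, the point `v` stands for the coset `κ⁻¹ v * G`, and `a v` is the
representative in `range π` of `g * κ⁻¹ v * G`. -/
structure IsCosetTranslation (κ : OpenPartialHomeomorph U E) (π : E →L[𝕜] E) (G : Subgroup U)
    (ρ : ℝ) (g : U) (a : E → E) : Prop where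
  mem_target : ∀ v ∈ ball 0 ρ, a v ∈ κ.target
  proj_apply : ∀ v ∈ ball 0 ρ, π (a v) = a v
  mul_mem : ∀ v ∈ ball 0 ρ, (κ.symm (a v))⁻¹ * (g * κ.symm v) ∈ G

namespace IsAdaptedChart

variable {κ : OpenPartialHomeomorph U E} {π : E →L[𝕜] E} {G : Subgroup U}
  (hκ : IsAdaptedChart 𝕜 κ π G)
include hκ

theorem eq_proj {w : E} {x : U} (hw : w ∈ κ.target) (hπw : π w = w) (hx : x ∈ κ.source)
    (hwx : (κ.symm w)⁻¹ * x ∈ G) : w = π (κ x) := by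
  rwa [hκ.inv_mul_mem_iff _ (κ.map_target hw) _ hx, κ.right_inv hw, hπw] at hwx

theorem isQuadLocalAction [IsTopologicalGroup U] {K : Type*} [Group K] [TopologicalSpace K]
    {φ : K →ₜ* U} {α : K → E → E} {ρ : ℝ} {B : ℝ≥0}
    (hα : ∀ s, IsCosetTranslation κ π G ρ (φ s) (α s))
    (hquad : ∀ s, QuadApprox 𝕜 (α s) (ball 0 ρ) B) : IsQuadLocalAction 𝕜 α ρ B where
  quadApprox := hquad
  mul_apply s t v hv htv := by
    have hst := (hα (s * t)).mem_target v hv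
    rw [← (hα (s * t)).proj_apply v hv, ← κ.right_inv hst]
    refine hκ.eq_proj ((hα s).mem_target _ htv) ((hα s).proj_apply _ htv) (κ.map_target hst) ?_
    simpa [mul_assoc] using G.mul_mem (G.mul_mem ((hα s).mul_mem _ htv) ((hα t).mul_mem v hv))
      (G.inv_mem ((hα (s * t)).mul_mem v hv))
  continuous_orbit v hv := by
    refine continuous_iff_continuousAt.2 fun t => ?_
    let x (s : K) : U := φ s * (φ t)⁻¹ * κ.symm (α t v)
    have hxt : x t = κ.symm (α t v) := by simp [x]
    have hxt_mem : x t ∈ κ.source := hxt ▸ κ.map_target ((hα t).mem_target v hv)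
    have hx : Continuous x := by fun_prop
    have hcont : ContinuousAt (fun s => π (κ (x s))) t :=
      π.continuous.continuousAt.comp ((κ.continuousAt hxt_mem).comp hx.continuousAt)
    refine hcont.congr ?_
    filter_upwards [hx.continuousAt.eventually_mem (κ.open_source.mem_nhds hxt_mem)] with s hs
    refine (hκ.eq_proj ((hα s).mem_target v hv) ((hα s).proj_apply v hv) hs ?_).symm
    simpa [x, mul_assoc] using G.mul_mem ((hα s).mul_mem v hv) (G.inv_mem ((hα t).mul_mem v hv))

variable [LieGroup 𝓘(𝕜, E) 2 U]

theorem exists_quadApprox_proj_mul :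
    ∃ B : ℝ≥0, ∃ r > 0,
      QuadApprox 𝕜 (fun p : E × E => π (κ (κ.symm p.1 * κ.symm p.2))) (ball (0, 0) r) B ∧
      ∀ p ∈ ball ((0 : E), (0 : E)) r,
        π (κ (κ.symm p.1 * κ.symm p.2)) ∈ κ.target ∧
        (κ.symm (π (κ (κ.symm p.1 * κ.symm p.2))))⁻¹ * (κ.symm p.1 * κ.symm p.2) ∈ G := by
  have := topologicalGroup_of_lieGroup 𝓘(𝕜, E) (G := U) 2
  have hf : ContDiffAt 𝕜 2 (fun p : E × E => π (κ (κ.symm p.1 * κ.symm p.2))) (0, 0) :=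
    π.contDiff.contDiffAt.comp (0, 0) hκ.contDiffAt_mul
  have hf0 : π (κ (κ.symm 0 * κ.symm 0)) = 0 := by simp [hκ.symm_zero, hκ.map_one]
  have hmul : Tendsto (fun p : E × E => κ.symm p.1 * κ.symm p.2) (𝓝 (0, 0)) (𝓝 1) := by
    rw [nhds_prod_eq]
    simpa using (hκ.tendsto_symm.comp tendsto_fst).mul (hκ.tendsto_symm.comp tendsto_snd)
  have htarget := hf.continuousAt.eventually_mem
    (κ.open_target.mem_nhds (by simpa only [hf0] using hκ.zero_mem_target))
  have hsource := hmul.eventually_mem (κ.open_source.mem_nhds hκ.one_mem_source)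
  obtain ⟨B, hB⟩ := exists_quadApprox_of_contDiffAt hf
  have hball := hB.and (eventually_ball_subset (htarget.and hsource))
  obtain ⟨r, ⟨hrB, hr⟩, hr0⟩ :=
    ((hball.filter_mono nhdsWithin_le_nhds).and (self_mem_nhdsWithin (s := Ioi (0 : ℝ)))).exists
  refine ⟨B, r, hr0, hrB, fun p hp => ⟨(hr hp).1, ?_⟩⟩
  rw [hκ.inv_mul_mem_iff _ (κ.map_target (hr hp).1) _ (hr hp).2, κ.right_inv (hr hp).1,
    hκ.proj_proj]

/-- If `g * G = u * G`, then `g * κ⁻¹ v * G = (g * κ⁻¹ v * g⁻¹) * u * G`, so the translation is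
`v ↦ π (κ (κ⁻¹ (chartConj κ g v) * u))`. -/
theorem exists_isCosetTranslation (C : ℝ) :
    ∃ ρ > 0, ∃ B : ℝ≥0, ∀ δ > 0, ∀ᶠ u in 𝓝 (1 : U), ∀ g : U, ‖Ad 𝕜 E g‖ ≤ C → g⁻¹ * u ∈ G →
      ∃ a : E → E, IsCosetTranslation κ π G ρ g a ∧ QuadApprox 𝕜 a (ball 0 ρ) B ∧ ‖a 0‖ ≤ δ := by
  obtain ⟨r, hr, L, hconj⟩ := hκ.exists_quadApprox_chartConj C
  obtain ⟨B, r', hr', hquad, hmul⟩ := hκ.exists_quadApprox_proj_mul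
  let f : E × E → E := fun p => π (κ (κ.symm p.1 * κ.symm p.2))
  obtain ⟨ρ, hLρ, hρ⟩ :=
    ((eventually_nhdsGT_zero_mul_lt L hr').and (Ioo_mem_nhdsGT hr)).exists
  have hρr : ball (0 : E) ρ ⊆ ball 0 r := ball_subset_ball hρ.2.le
  refine ⟨ρ, hρ.1, B * L ^ 2 + B * L, fun δ hδ => ?_⟩
  have hf0 : Tendsto (fun u => f (0, κ u)) (𝓝 1) (𝓝 0) := by
    have hf : Tendsto f (𝓝 (0, 0)) (𝓝 (f (0, 0))) :=
      hquad.continuousOn.continuousAt (ball_mem_nhds _ hr')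
    have hf00 : f (0, 0) = 0 := by simp [f, hκ.symm_zero, hκ.map_one]
    rw [hf00] at hf
    exact hf.comp (tendsto_const_nhds.prodMk_nhds hκ.tendsto)
  filter_upwards [κ.open_source.mem_nhds hκ.one_mem_source,
    hκ.tendsto.eventually_mem (ball_mem_nhds 0 hr'),
    hf0.eventually_mem (closedBall_mem_nhds 0 hδ)] with u hu hur huδ g hg hgu
  obtain ⟨hsource, hL, hc⟩ := hconj g hg
  have hmaps : MapsTo (chartConj κ g) (ball 0 ρ) (ball 0 r') := fun v hv => by
    have hle := hL.norm_sub_le (hρr hv) (mem_ball_self hr)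
    rw [hκ.chartConj_zero, sub_zero, sub_zero] at hle
    rw [mem_ball_zero_iff] at hv ⊢
    exact (hle.trans (by gcongr)).trans_lt hLρ
  have hball : ∀ v ∈ ball 0 ρ, (chartConj κ g v, κ u) ∈ ball ((0 : E), (0 : E)) r' :=
    fun v hv => by
      rw [← ball_prod_same]
      exact ⟨hmaps hv, hur⟩
  refine ⟨fun v => f (chartConj κ g v, κ u),
    ⟨fun v hv => (hmul _ (hball v hv)).1, fun v _ => hκ.proj_proj _, fun v hv => ?_⟩,
    (hquad.comp_prodMk_right hur).comp (hc.mono hρr) (hL.mono hρr) hmaps, ?_⟩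
  · have hv' := hsource v (hρr hv)
    have hfG := G.mul_mem (hmul _ (hball v hv)).2 (G.inv_mem hgu)
    simp only [chartConj, κ.left_inv hu, κ.left_inv hv'] at hfG
    simp only [f, chartConj, κ.left_inv hu, κ.left_inv hv']
    simpa [mul_assoc] using hfG
  · simpa [hκ.chartConj_zero] using huδ

theorem exists_forall_conj_mem [CompleteSpace E] {V : Set U} (hV : V ∈ 𝓝 1) (C : ℝ) :
    ∃ U₀ ∈ 𝓝 (1 : U),
      ∀ (K : Type*) [Group K] [TopologicalSpace K] [IsTopologicalGroup K] [CompactSpace K]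
        (φ : K →ₜ* U), (∀ s, φ s ∈ (G : Set U) * U₀) → (∀ s, ‖Ad 𝕜 E (φ s)‖ ≤ C) →
        ∃ x ∈ V, ∀ s, x⁻¹ * φ s * x ∈ G := by
  have := topologicalGroup_of_lieGroup 𝓘(𝕜, E) (G := U) 2
  obtain ⟨ρ, hρ, B, htrans⟩ := hκ.exists_isCosetTranslation C
  obtain ⟨η, hη, hηV⟩ : ∃ η > 0, ∀ y ∈ ball 0 η, κ.symm y ∈ V :=
    eventually_nhds_iff_ball.1 (hκ.tendsto_symm hV)
  obtain ⟨δ, ⟨hδ, hδB⟩, hδ0⟩ := (((eventually_nhdsGT_zero_mul_lt 2 (lt_min hρ hη)).and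
    (eventually_nhdsGT_zero_mul_lt (8 * B) one_pos)).and self_mem_nhdsWithin).exists
  refine ⟨_, inv_mem_nhds_one U (htrans δ hδ0), fun K _ _ _ _ φ hφ hC => ?_⟩
  have haction : ∀ s, ∃ a : E → E, IsCosetTranslation κ π G ρ (φ s) a ∧
      QuadApprox 𝕜 a (ball 0 ρ) B ∧ ‖a 0‖ ≤ δ := fun s => by
    obtain ⟨γ, hγ, u, hu, hγu⟩ := hφ s⁻¹
    refine hu (φ s) (hC s) ?_
    rwa [← map_inv, ← hγu, mul_inv_cancel_right]
  choose α hα hquad hα0 using haction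
  obtain ⟨v, hv, hfix⟩ := (hκ.isQuadLocalAction hα hquad).exists_fixed_point hα0
    (hδ.trans_le (min_le_left _ _)) hδB.le
  refine ⟨κ.symm v, hηV v ?_, fun s => ?_⟩
  · exact mem_ball_zero_iff.2 (hv.trans_lt (hδ.trans_le (min_le_right _ _)))
  · have hvρ : v ∈ ball 0 ρ := mem_ball_zero_iff.2 (hv.trans_lt (hδ.trans_le (min_le_left _ _)))
    simpa only [hfix, mul_assoc] using (hα s).mul_mem v hvρ

end IsAdaptedChart

end CosetTranslation

section Conjugation

variable {U : Type*} [Group U]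

theorem exists_nhds_dist_one_inv_mul_lt [PseudoMetricSpace U] [IsTopologicalGroup U] {ε : ℝ}
    (hε : 0 < ε) : ∃ V ∈ 𝓝 (1 : U), ∀ x ∈ V, ∀ y ∈ V, dist 1 (x⁻¹ * y) < ε := by
  have hcont : Continuous fun p : U × U => dist 1 (p.1⁻¹ * p.2) := by fun_prop
  have hlim : Tendsto (fun p : U × U => dist 1 (p.1⁻¹ * p.2)) (𝓝 1 ×ˢ 𝓝 1) (𝓝 0) := by
    simpa [nhds_prod_eq] using hcont.tendsto (1, 1)
  exact (eventually_prod_self_iff (r := fun x y => dist 1 (x⁻¹ * y) < ε)).1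
    (hlim.eventually_lt_const hε)

theorem dist_conj_lt [PseudoMetricSpace U]
    (hd : (∀ a x y : U, dist (a * x) (a * y) = dist x y) ∨
      (∀ a x y : U, dist (x * a) (y * a) = dist x y))
    {V : Set U} {ε : ℝ} (hV : ∀ x ∈ V, ∀ y ∈ V, dist 1 (x⁻¹ * y) < ε) {g x : U} (hx : x ∈ V)
    (hgx : g * x * g⁻¹ ∈ V) (hgx' : g⁻¹ * x * g ∈ V) : dist g (x⁻¹ * g * x) < ε := by
  rcases hd with hleft | hright
  · calc dist g (x⁻¹ * g * x) = dist (g * 1) (g * ((g⁻¹ * x * g)⁻¹ * x)) := by group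
      _ = dist 1 ((g⁻¹ * x * g)⁻¹ * x) := hleft _ _ _
      _ < ε := hV _ hgx' _ hx
  · calc dist g (x⁻¹ * g * x) = dist (1 * g) (x⁻¹ * (g * x * g⁻¹) * g) := by group
      _ = dist 1 (x⁻¹ * (g * x * g⁻¹)) := hright _ _ _
      _ < ε := hV _ hx _ hgx

theorem exists_continuousMonoidHom_conj [TopologicalSpace U] [IsTopologicalGroup U]
    {G : Subgroup U} {K : Type*} [Group K] [TopologicalSpace K] (φ : K →ₜ* U) {x : U}
    (hx : ∀ s, x⁻¹ * φ s * x ∈ G) :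
    ∃ ψ : K →ₜ* G, (∀ s, (ψ s : U) = x⁻¹ * φ s * x) ∧
      (Topology.IsEmbedding φ → Topology.IsEmbedding ψ) := by
  refine ⟨{ toFun := fun s => ⟨x⁻¹ * φ s * x, hx s⟩
            map_one' := by ext; simp
            map_mul' := fun s t => by ext; simp [mul_assoc]
            continuous_toFun := Continuous.subtype_mk (by fun_prop) hx },
    fun s => rfl, fun hφ => ?_⟩
  exact (((Homeomorph.mulLeft x⁻¹).trans (Homeomorph.mulRight x)).isEmbedding.comp hφ).codRestrict
    (G : Set U) hx

end Conjugation

end BanachLie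

open BanachLie in
theorem theorem1p2_general {𝕜 : Type*} [RCLike 𝕜]
    {E : Type*} [NormedAddCommGroup E] [NormedSpace 𝕜 E] [CompleteSpace E]
    {U : Type*} [Group U] [MetricSpace U] [ChartedSpace E U] [LieGroup 𝓘(𝕜, E) 2 U]
    (hd : (∀ a x y : U, dist (a * x) (a * y) = dist x y) ∨
      (∀ a x y : U, dist (x * a) (y * a) = dist x y))
    (G : Subgroup U)
    (hG : ∃ χ ∈ IsManifold.maximalAtlas 𝓘(𝕜, E) 2 U, (1 : U) ∈ χ.source ∧
      ∃ F : Submodule 𝕜 E, F.ClosedComplemented ∧ ∀ x ∈ χ.source, x ∈ G ↔ χ x ∈ F)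
    (S : Set U) (hS : AdBounded 𝕜 E S) (ε : ℝ) (hε : 0 < ε) :
    ∃ U₀ ∈ 𝓝 (1 : U),
      ∀ (K : Type*) [Group K] [TopologicalSpace K] [IsTopologicalGroup K] [CompactSpace K]
        (φ : K →ₜ* U), (∀ s : K, φ s ∈ ((G : Set U) * U₀) ∩ S) →
        ∃ ψ : K →ₜ* G, (∀ s : K, dist (φ s) (ψ s : U) < ε) ∧
          (Topology.IsEmbedding φ → Topology.IsEmbedding ψ) := by
  have := topologicalGroup_of_lieGroup 𝓘(𝕜, E) (G := U) 2
  obtain ⟨χ, hχ, h1χ, F, hF, hGF⟩ := hG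
  obtain ⟨κ₀, π, hκ₀, hπ, hκ₀G⟩ := exists_isCenteredChart_mem_iff hχ h1χ hF hGF
  obtain ⟨κ, hκ⟩ := exists_isAdaptedChart hκ₀ hπ hκ₀G
  obtain ⟨C, hC⟩ := hS
  obtain ⟨V, hV, hVε⟩ := exists_nhds_dist_one_inv_mul_lt (U := U) hε
  obtain ⟨U₀, hU₀, hconj⟩ :=
    hκ.exists_forall_conj_mem (Filter.inter_mem hV (hκ.eventually_conj_mem hV C)) C
  refine ⟨U₀, hU₀, fun K _ _ _ _ φ hφ => ?_⟩
  have hφC : ∀ s, ‖Ad 𝕜 E (φ s)‖ ≤ C := fun s => hC _ (hφ s).2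
  obtain ⟨x, ⟨hxV, hxconj⟩, hxG⟩ := hconj K φ (fun s => (hφ s).1) hφC
  obtain ⟨ψ, hψ, hemb⟩ := exists_continuousMonoidHom_conj φ hxG
  refine ⟨ψ, fun s => ?_, hemb⟩
  rw [hψ]
  exact dist_conj_lt hd hVε hxV (hxconj _ (hφC s)) (by simpa using hxconj _ (hφC s⁻¹))

theorem theorem1p2 {𝕜 : Type*} [RCLike 𝕜]
    {E : Type*} [NormedAddCommGroup E] [NormedSpace 𝕜 E] [CompleteSpace E]
    {U : Type*} [Group U] [MetricSpace U] [ChartedSpace E U] [LieGroup 𝓘(𝕜, E) ω U]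
    (hd : (∀ a x y : U, dist (a * x) (a * y) = dist x y) ∨
      (∀ a x y : U, dist (x * a) (y * a) = dist x y))
    (G : Subgroup U) (hG : BanachLie.IsLieSubgroup 𝕜 E G)
    (S : Set U) (hS : BanachLie.AdBounded 𝕜 E S) (ε : ℝ) (hε : 0 < ε) :
    ∃ U₀ ∈ 𝓝 (1 : U),
      ∀ (K : Type*) [Group K] [TopologicalSpace K] [IsTopologicalGroup K] [CompactSpace K]
        (φ : K →ₜ* U), (∀ s : K, φ s ∈ ((G : Set U) * U₀) ∩ S) →
        ∃ ψ : K →ₜ* G, (∀ s : K, dist (φ s) (ψ s : U) < ε) ∧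
          (Topology.IsEmbedding φ → Topology.IsEmbedding ψ) := by
  have : LieGroup 𝓘(𝕜, E) 2 U := LieGroup.of_le (n := ω) le_top
  obtain ⟨χ, hχ, h1χ, hF⟩ := hG 1 G.one_mem
  exact theorem1p2_general hd G
    ⟨χ, IsManifold.maximalAtlas_subset_of_le le_top hχ, h1χ, hF⟩ S hS ε hε
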